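/- Let $f_1,\dots,f_p,\ g_1,\dots,g_m,\ h_1,\dots,h_r:\mathbb{R}^n\to\mathbb{R}$ be locally Lipschitz, let $\mathcal F=\{x\in\mathbb{R}^n : g_i(x)\le 0\ (1\le i\le m),\ h_j(x)=0\ (1\le j\le r)\}$, and let $\bar x\in\mathcal F$ be a local weak efficient solution of minimizing $f=(f_1,\dots,f_p)$ over $\mathcal F$; that is, there is a neighbourhood $U$ of $\bar x$ such that no $x\in U\cap\mathcal F$ satisfies $f_l(x)<f_l(\bar x)$ for all $l=1,\dots,p$. For $\varphi:\mathbb{R}^n\to\mathbb{R}$ let $\partial\varphi(x)=\{x^*\in\mathbb{R}^n : (x^*,-1)\in N((x,\varphi(x));\operatorname{epi}\varphi)\}$ be the Mordukhovich (limiting) subdifferential, where for a set $S$ the limiting normal cone $N(\bar z;S)$ consists of all limits $z^*=\lim_k z_k^*$ for which there are $z^k\in S$ with $z^k\to\bar z$ and $\varepsilon_k\to0^+$ such that $\limsup_{u\to z^k,\,u\in S}\langle z_k^*,u-z^k\rangle/\|u-z^k\|\le\varepsilon_k$ for all $k$. Then, without any constraint qualification, there exist signs $s_1,\dots,s_r\in\{1,-1\}$,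 depending on neither $k$ nor the points $x^k$ below, such that with $\bar h_j:=s_jh_j$ (replacing $h_j$ by $\bar h_j$ changes neither $\mathcal F$ nor the sets $\partial h_j(x)\cup\partial(-h_j)(x)$) the following holds. There exist sequences $x^k\in\mathbb{R}^n$, $\lambda^k\in\mathbb{R}^p_+$, $\mu^k\in\mathbb{R}^m_+$, $\tau^k\in\mathbb{R}^r$ $(k\in\mathbb{N})$ satisfying the approximate Karush--Kuhn--Tucker (AKKT) condition at $\bar x$: * (A0) $x^k\to\bar x$; * (A1) $\displaystyle\inf\Big\{\Big\|\sum_{l=1}^p\lambda_l^k\xi_l+\sum_{i=1}^m\mu_i^k\eta_i+\sum_{j=1}^r\tau_j^k\gamma_j\Big\| : \xi_l\in\partial f_l(x^k),\ \eta_i\in\partial g_i(x^k),\ \gamma_j\in\partial h_j(x^k)\cup\partial(-h_j)(x^k)\Big\}\to0$ as $k\to\infty$ (with $\inf\emptyset=+\infty$); * (A2) $\sum_{l=1}^p\lambda_l^k=1$ for all $k$; * (A3) for every $i$ with $g_i(\bar x)<0$, $\mu_i^k=0$ for all sufficiently large $k$; and these sequences can be chosen so that, moreover: * (E1) there are $b_k,c_k>0$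 such that $\mu_i^k=b_k\max(g_i(x^k),0)\ge0$ for all $i$ and $\tau_j^k=c_k\bar h_j(x^k)\ge0$ for all $j$, for every $k$; * (E2) $f_l(x^k)-f_l(\bar x)+\frac12\Big[\sum_{i=1}^m\mu_i^kg_i(x^k)+\sum_{j=1}^r\tau_j^k\bar h_j(x^k)\Big]\le0$ for all $k$ and all $l$. -/

import Mathlib

open Filter Topology
open scoped ENNReal

namespace AKKT

noncomputable section

section VariationalAnalysis

variable {V : Type*} [NormedAddCommGroup V] [InnerProductSpace ℝ V]

/-- The set of `ε`-normals of `S` at `x`: all `z` with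
`limsup ⟨z, u - x⟩ / ‖u - x‖ ≤ ε` as `u → x`, `u ∈ S`, `u ≠ x`. The upper limit is taken in
the extended reals, so it is `-∞` at an isolated point of `S`. -/
def epsNormals (ε : ℝ) (x : V) (S : Set V) : Set V :=
  {z | limsup (fun u : V => ((inner ℝ z (u - x) / ‖u - x‖ : ℝ) : EReal)) (𝓝[S \ {x}] x)
    ≤ (ε : EReal)}

/-- The Mordukhovich (limiting) normal cone of `S` at `x`. -/
def limitingNormalCone (x : V) (S : Set V) : Set V :=
  {z | ∃ (y : ℕ → V) (ε : ℕ → ℝ) (w : ℕ → V),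
    (∀ k, y k ∈ S) ∧ Tendsto y atTop (𝓝 x) ∧
    (∀ k, 0 < ε k) ∧ Tendsto ε atTop (𝓝 0) ∧
    Tendsto w atTop (𝓝 z) ∧ ∀ k, w k ∈ epsNormals (ε k) (y k) S}

/-- The epigraph of a real-valued function, in `V × ℝ` with the Euclidean product norm. -/
def epigraph (φ : V → ℝ) : Set (WithLp 2 (V × ℝ)) :=
  {q | φ q.fst ≤ q.snd}

/-- The Mordukhovich (limiting) subdifferential of a real-valued function at `x`: all `z` such
that `(z, -1)` is a limiting normal of the epigraph at `(x, φ x)`. -/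
def limitingSubdifferential (φ : V → ℝ) (x : V) : Set V :=
  {z | WithLp.toLp 2 (z, (-1 : ℝ)) ∈
    limitingNormalCone (WithLp.toLp 2 (x, φ x)) (epigraph φ)}

end VariationalAnalysis

section Problem

variable {n p m r : ℕ}

/-- The set of all `x` with `g_i(x) ≤ 0` for all `i` and `h_j(x) = 0` for all `j`. -/
def feasibleSet (g : Fin m → EuclideanSpace ℝ (Fin n) → ℝ)
    (h : Fin r → EuclideanSpace ℝ (Fin n) → ℝ) : Set (EuclideanSpace ℝ (Fin n)) :=
  {x | (∀ i, g i x ≤ 0) ∧ ∀ j, h j x = 0}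

/-- `x₀` lies in `S`, and no point of `S` is strictly better in every objective. -/
def IsWeakEfficientOn (f : Fin p → EuclideanSpace ℝ (Fin n) → ℝ)
    (S : Set (EuclideanSpace ℝ (Fin n))) (x₀ : EuclideanSpace ℝ (Fin n)) : Prop :=
  x₀ ∈ S ∧ ¬ ∃ x ∈ S, ∀ l, f l x < f l x₀

/-- Local weak efficient solutions of the constrained multiobjective problem. -/
def IsLocalWeakEfficient (f : Fin p → EuclideanSpace ℝ (Fin n) → ℝ)
    (g : Fin m → EuclideanSpace ℝ (Fin n) → ℝ) (h : Fin r → EuclideanSpace ℝ (Fin n) → ℝ)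
    (x₀ : EuclideanSpace ℝ (Fin n)) : Prop :=
  ∃ U ∈ 𝓝 x₀, IsWeakEfficientOn f (U ∩ feasibleSet g h) x₀

/-- The infimum of `‖∑ λ_l ξ_l + ∑ μ_i η_i + ∑ τ_j γ_j‖` over `ξ_l ∈ ∂f_l(x)`,
`η_i ∈ ∂g_i(x)` and `γ_j ∈ ∂h_j(x) ∪ ∂(-h_j)(x)`. It is taken in `[0, ∞]`, so that it is `∞`
if one of these sets is empty. -/
def stationarityMeasure (f : Fin p → EuclideanSpace ℝ (Fin n) → ℝ)
    (g : Fin m → EuclideanSpace ℝ (Fin n) → ℝ) (h : Fin r → EuclideanSpace ℝ (Fin n) → ℝ)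
    (x : EuclideanSpace ℝ (Fin n)) (lam : Fin p → ℝ) (mu : Fin m → ℝ) (tau : Fin r → ℝ) :
    ℝ≥0∞ :=
  sInf {a | ∃ (ξ : Fin p → EuclideanSpace ℝ (Fin n)) (η : Fin m → EuclideanSpace ℝ (Fin n))
      (γ : Fin r → EuclideanSpace ℝ (Fin n)),
    (∀ l, ξ l ∈ limitingSubdifferential (f l) x) ∧
    (∀ i, η i ∈ limitingSubdifferential (g i) x) ∧
    (∀ j, γ j ∈ limitingSubdifferential (h j) x ∪
      limitingSubdifferential (fun y => -h j y) x) ∧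
    a = ENNReal.ofReal ‖∑ l, lam l • ξ l + ∑ i, mu i • η i + ∑ j, tau j • γ j‖}

/-- The sequences `x`, `(lam, mu, tau)` witness the approximate Karush-Kuhn-Tucker condition
at `x₀`. -/
structure SatisfiesAKKT (f : Fin p → EuclideanSpace ℝ (Fin n) → ℝ)
    (g : Fin m → EuclideanSpace ℝ (Fin n) → ℝ) (h : Fin r → EuclideanSpace ℝ (Fin n) → ℝ)
    (x₀ : EuclideanSpace ℝ (Fin n)) (x : ℕ → EuclideanSpace ℝ (Fin n))
    (lam : ℕ → Fin p → ℝ) (mu : ℕ → Fin m → ℝ) (tau : ℕ → Fin r → ℝ) : Prop where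
  feasible : x₀ ∈ feasibleSet g h
  lam_nonneg : ∀ k l, 0 ≤ lam k l
  mu_nonneg : ∀ k i, 0 ≤ mu k i
  tendsto_x : Tendsto x atTop (𝓝 x₀)
  tendsto_measure : Tendsto
    (fun k => stationarityMeasure f g h (x k) (lam k) (mu k) (tau k)) atTop (𝓝 0)
  sum_lam : ∀ k, ∑ l, lam k l = 1
  inactive : ∀ i, g i x₀ < 0 → ∀ᶠ k in atTop, mu k i = 0

/-- `μ_i^k = b_k max(g_i(x^k), 0) ≥ 0` and `τ_j^k = c_k h_j(x^k) ≥ 0` with `b_k, c_k > 0`. -/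
def ConditionE1 (g : Fin m → EuclideanSpace ℝ (Fin n) → ℝ)
    (h : Fin r → EuclideanSpace ℝ (Fin n) → ℝ) (x : ℕ → EuclideanSpace ℝ (Fin n))
    (mu : ℕ → Fin m → ℝ) (tau : ℕ → Fin r → ℝ) : Prop :=
  ∃ b c : ℕ → ℝ, (∀ k, 0 < b k) ∧ (∀ k, 0 < c k) ∧
    (∀ k i, mu k i = b k * max (g i (x k)) 0 ∧ 0 ≤ mu k i) ∧
    ∀ k j, tau k j = c k * h j (x k) ∧ 0 ≤ tau k j

/-- `f_l(x^k) - f_l(x₀) + (1/2) [∑ μ_i^k g_i(x^k) + ∑ τ_j^k h_j(x^k)] ≤ 0` for all `k`, `l`. -/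
def ConditionE2 (f : Fin p → EuclideanSpace ℝ (Fin n) → ℝ)
    (g : Fin m → EuclideanSpace ℝ (Fin n) → ℝ) (h : Fin r → EuclideanSpace ℝ (Fin n) → ℝ)
    (x₀ : EuclideanSpace ℝ (Fin n)) (x : ℕ → EuclideanSpace ℝ (Fin n))
    (mu : ℕ → Fin m → ℝ) (tau : ℕ → Fin r → ℝ) : Prop :=
  ∀ k l, f l (x k) - f l x₀ +
    (1 / 2 : ℝ) * (∑ i, mu k i * g i (x k) + ∑ j, tau k j * h j (x k)) ≤ 0

end Problem

end

end AKKT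

namespace AKKT

/-! Weak efficiency says that `(0, x₀)` is a local solution of the scalar problem of minimizing `t`
subject to `f l x - f l x₀ ≤ t`, `g i x ≤ 0`, `h j x ≤ 0` and `-h j x ≤ 0`. The objective
constraints are kept exact. The others receive the quadratic penalty with weight `k + 1`, and `‖x -
x₀‖ ^ 2 / 2` is added. Minimizers `(t k, x k)` over a small ball converge to `(0, x₀)`
(`exists_penalty_minimizers`), and comparison with the value `0` at `(0, x₀)` bounds `t k` plus the
penalties by `0`. As `f l (x k) - f l x₀ ≤ t k`, this is (E2).

Stationarity is needed at `x k` itself, with limiting subgradients of each function separately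
(`exists_multipliers`). This is obtained by decoupling: every function gets its own copy of the
variable, a quadratic term of weight `N` ties the copies to `x`, and the exact constraints are
penalized with weight `N`. A minimizer of the decoupled problem yields normals to the individual
epigraphs. Local Lipschitz continuity bounds the subgradients, and the `t`-derivative bounds the
objective multipliers and makes them sum to one, so a limit `N → ∞` exists. For a penalized
constraint the multiplier is the derivative of its penalty, which is the formula in (E1). The
resulting sum of weighted subgradients is `-(x k - x₀)`, which tends to zero. Finally, a subsequence
fixes the sign pattern of the equality constraints. -/

/-- Half the square of the positive part, the quadratic penalty of the constraint `s ≤ 0`. -/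
noncomputable def quadPenalty (s : ℝ) : ℝ := max s 0 ^ 2 / 2

lemma quadPenalty_nonneg (s : ℝ) : 0 ≤ quadPenalty s := by
  unfold quadPenalty; positivity

lemma quadPenalty_mono : Monotone quadPenalty := by
  intro a b hab
  unfold quadPenalty
  gcongr

lemma continuous_quadPenalty : Continuous quadPenalty := by
  unfold quadPenalty; fun_prop

lemma quadPenalty_eq_zero_iff {s : ℝ} : quadPenalty s = 0 ↔ s ≤ 0 := by
  simp [quadPenalty]

lemma hasDerivAt_quadPenalty (s : ℝ) : HasDerivAt quadPenalty (max s 0) s := by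
  have hpos : ∀ u : ℝ, HasDerivAt (fun v : ℝ => v ^ 2 / 2) u u := fun u => by
    simpa using (hasDerivAt_pow 2 u).div_const 2
  rcases lt_trichotomy s 0 with hs | rfl | hs
  · rw [max_eq_right hs.le]
    refine (hasDerivAt_const s (0 : ℝ)).congr_of_eventuallyEq ?_
    filter_upwards [gt_mem_nhds hs] with u hu
    exact quadPenalty_eq_zero_iff.2 (le_of_lt hu)
  -- At the kink the penalty is dominated by `u ^ 2 / 2`, whose derivative vanishes there.
  · rw [max_self, hasDerivAt_iff_isLittleO]
    have h0 := (hasDerivAt_iff_isLittleO.1 (hpos 0))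
    refine (Asymptotics.IsBigO.of_bound 1 (Eventually.of_forall fun u => ?_)).trans_isLittleO h0
    rcases le_total u 0 with hu | hu <;> simp [quadPenalty, hu]
    positivity
  · rw [max_eq_left hs.le]
    refine (hpos s).congr_of_eventuallyEq ?_
    filter_upwards [lt_mem_nhds hs] with u hu
    simp [quadPenalty, max_eq_left (le_of_lt hu)]

/-! ### Normals of epigraphs from smooth perturbations -/

section Normals

variable {V : Type*} [NormedAddCommGroup V] [InnerProductSpace ℝ V]

/-- At a local minimum on `S` the negative gradient is an `ε`-normal of `S`. -/
lemma mem_epsNormals_of_isLocalMinOn {Θ : V → ℝ} {S : Set V} {q z : V}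
    (hmin : IsLocalMinOn Θ S q) (hΘ : HasFDerivAt Θ (-(innerSL ℝ z)) q) {ε : ℝ} (hε : 0 < ε) :
    z ∈ epsNormals ε q S := by
  change limsup (fun u : V => ((inner ℝ z (u - q) / ‖u - q‖ : ℝ) : EReal)) (𝓝[S \ {q}] q) ≤ ε
  refine limsup_le_of_le (h := ?_)
  have h1 := hΘ.isLittleO.bound hε
  have h2 : ∀ᶠ u in 𝓝[S \ {q}] q, Θ q ≤ Θ u :=
    hmin.filter_mono (nhdsWithin_mono _ Set.sdiff_subset)
  filter_upwards [h2, nhdsWithin_le_nhds h1] with u hu hu'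
  rw [EReal.coe_le_coe_iff]
  refine div_le_of_le_mul₀ (norm_nonneg _) hε.le ?_
  have := (abs_le.1 hu').2
  simp only [neg_apply, innerSL_apply_apply] at this
  linarith

/-- Since `θ` is monotone, `(y, F y)` locally minimizes `θ s + N * (‖v - x‖ ^ 2 / 2)` over the
points `(v, s)` of the epigraph. The negative gradient there is `(N • (x - y), -d)`; dividing by `d
> 0` normalizes the last coordinate. -/
lemma mem_epsNormals_epigraph_of_isLocalMin {F : V → ℝ} {θ : ℝ → ℝ} {x y : V} {N d : ℝ}
    (hθ : Monotone θ) (hd : 0 < d) (hθ' : HasDerivAt θ d (F y))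
    (hmin : IsLocalMin (fun v => θ (F v) + N * (‖v - x‖ ^ 2 / 2)) y) {ε : ℝ} (hε : 0 < ε) :
    WithLp.toLp 2 ((N / d) • (x - y), (-1 : ℝ)) ∈
      epsNormals ε (WithLp.toLp 2 (y, F y)) (epigraph F) := by
  let Θ : WithLp 2 (V × ℝ) → ℝ := fun w => d⁻¹ * (θ w.snd + N * (‖w.fst - x‖ ^ 2 / 2))
  refine mem_epsNormals_of_isLocalMinOn (Θ := Θ) ?_ ?_ hε
  · have ht : Tendsto (fun w : WithLp 2 (V × ℝ) => w.fst) (𝓝 (WithLp.toLp 2 (y, F y))) (𝓝 y) :=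
      (WithLp.fstL 2 ℝ V ℝ).continuous.tendsto (WithLp.toLp 2 (y, F y))
    filter_upwards [nhdsWithin_le_nhds (ht.eventually hmin), self_mem_nhdsWithin] with w hw hwS
    have := hθ (show F w.fst ≤ w.snd from hwS)
    refine mul_le_mul_of_nonneg_left ?_ (inv_nonneg.2 hd.le)
    change θ (F y) + N * (‖y - x‖ ^ 2 / 2) ≤ _
    linarith
  · have h1 : HasFDerivAt (fun w : WithLp 2 (V × ℝ) => w.fst - x) (WithLp.fstL 2 ℝ V ℝ)
        (WithLp.toLp 2 (y, F y)) := (WithLp.fstL 2 ℝ V ℝ).hasFDerivAt.sub_const x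
    have h2 : HasFDerivAt (fun w : WithLp 2 (V × ℝ) => w.snd) (WithLp.sndL 2 ℝ V ℝ)
        (WithLp.toLp 2 (y, F y)) := (WithLp.sndL 2 ℝ V ℝ).hasFDerivAt
    have h3 : HasFDerivAt (fun w : WithLp 2 (V × ℝ) => θ w.snd) _
        (WithLp.toLp 2 (y, F y)) :=
      HasDerivAt.comp_hasFDerivAt (WithLp.toLp 2 (y, F y)) hθ' h2
    have h4 := (h3.add ((h1.norm_sq.mul_const (2⁻¹ : ℝ)).const_mul N)).const_mul d⁻¹
    refine (h4.congr_fderiv ?_).congr_of_eventuallyEq (Eventually.of_forall fun w => ?_)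
    · ext w
      simp [WithLp.prod_inner_apply, inner_smul_left]
      simp only [← neg_sub y x, inner_neg_left, inner_sub_left]
      field_simp
    · simp [Θ, div_eq_mul_inv]

/-- Moving from `y` towards `x` lowers the quadratic term at rate `N * ‖x - y‖ ^ 2` and raises `θ ∘
F` at rate at most `d * K * ‖x - y‖`; minimality compares the two. -/
lemma norm_le_of_isLocalMin {F : V → ℝ} {θ : ℝ → ℝ} {x y : V} {N d : ℝ} {K : NNReal}
    {U : Set V} (hU : U ∈ 𝓝 y) (hF : LipschitzOnWith K F U) (hθ : Monotone θ) (hd : 0 < d)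
    (hN : 0 < N) (hθ' : HasDerivAt θ d (F y))
    (hmin : IsLocalMin (fun v => θ (F v) + N * (‖v - x‖ ^ 2 / 2)) y) :
    ‖(N / d) • (x - y)‖ ≤ K := by
  set ℓ := ‖x - y‖ with hℓ
  -- Along the segment, `F` is replaced by its Lipschitz upper bound, which is differentiable and
  -- agrees with `F` at `s = 0`. The bound is valid for `s ≥ 0`, so the minimum is one-sided.
  let φ : ℝ → ℝ := fun s => θ (F y + K * ℓ * s) + N * (((1 - s) * ℓ) ^ 2 / 2)
  have hφ : HasDerivAt φ (d * (K * ℓ) - N * ℓ ^ 2) 0 := by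
    have h1 : HasDerivAt (fun s : ℝ => F y + K * ℓ * s) (K * ℓ) 0 := by
      simpa using ((hasDerivAt_id (0 : ℝ)).const_mul (K * ℓ)).const_add (F y)
    have h2 : HasDerivAt (fun s : ℝ => θ (F y + K * ℓ * s)) (d * (K * ℓ)) 0 :=
      HasDerivAt.comp (0 : ℝ) (by simpa using hθ') h1
    have h3 : HasDerivAt (fun s : ℝ => (1 - s) * ℓ) (-ℓ) 0 := by
      simpa using ((hasDerivAt_id (0 : ℝ)).const_sub 1).mul_const ℓ
    have h4 := h2.add (((h3.pow 2).div_const 2).const_mul N)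
    refine h4.congr_deriv ?_
    simp
    ring
  have hc : Tendsto (fun s : ℝ => y + s • (x - y)) (𝓝 0) (𝓝 y) := by
    have : Continuous (fun s : ℝ => y + s • (x - y)) := by fun_prop
    simpa using this.tendsto 0
  have hloc : IsLocalMinOn φ (Set.Ici 0) 0 := by
    filter_upwards [nhdsWithin_le_nhds (hc.eventually hmin), nhdsWithin_le_nhds (hc hU),
      self_mem_nhdsWithin] with s hs hsU hs0
    have e : ‖y + s • (x - y) - x‖ ^ 2 = ((1 - s) * ℓ) ^ 2 := by
      rw [show y + s • (x - y) - x = -((1 - s) • (x - y)) by module, norm_neg, norm_smul, mul_pow,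
        mul_pow]
      simp [hℓ]
    have hle : F (y + s • (x - y)) ≤ F y + K * ℓ * s := by
      have := hF.dist_le_mul _ hsU _ (mem_of_mem_nhds hU)
      rw [Real.dist_eq, dist_eq_norm, add_sub_cancel_left, norm_smul, Real.norm_eq_abs,
        abs_of_nonneg (show (0 : ℝ) ≤ s from hs0), ← hℓ] at this
      have := (abs_le.1 this).2
      linarith
    have h5 := hθ hle
    simp only [e] at hs
    simp only [φ, mul_zero, add_zero, sub_zero, one_mul]
    rw [← norm_sub_rev x y] at hs
    linarith
  have hnn : 0 ≤ d * (K * ℓ) - N * ℓ ^ 2 := by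
    have := hloc.hasFDerivWithinAt_nonneg hφ.hasFDerivAt.hasFDerivWithinAt (y := 1)
      (mem_posTangentConeAt_of_segment_subset (by
        rw [zero_add, segment_eq_Icc zero_le_one]; exact Set.Icc_subset_Ici_self))
    simpa using this
  rw [norm_smul, Real.norm_eq_abs, abs_of_pos (by positivity), ← hℓ, div_mul_eq_mul_div,
    div_le_iff₀ hd]
  rcases (norm_nonneg (x - y)).eq_or_lt with h0 | h0
  · rw [hℓ, ← h0]; simp; positivity
  · rw [← hℓ] at h0
    nlinarith

end Normals

/-! ### Convergence of penalty methods -/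

/-- Minimizers of penalized problems on a compact set converge to the strict minimizer of the
constrained problem. -/
lemma tendsto_of_penalty_minimizers {Y : Type*} [TopologicalSpace Y] [FirstCountableTopology Y]
    {S : Set Y} (hS : IsCompact S) {A B C : Y → ℝ} (hA : Continuous A)
    (hB : Continuous B) (hC : Continuous C) (hB0 : ∀ y, 0 ≤ B y) {q : Y} (hq : q ∈ S)
    (hBq : B q = 0) (huniq : ∀ y ∈ S, B y = 0 → A y ≤ A q → y = q) {u : ℕ → Y}
    (huS : ∀ n, u n ∈ S)
    (hu : ∀ n : ℕ, IsMinOn (fun y => A y + ((n : ℝ) + 1) * B y + ((n : ℝ) + 1)⁻¹ * C y) S (u n)) :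
    Tendsto u atTop (𝓝 q) := by
  refine hS.tendsto_nhds_of_unique_mapClusterPt (Eventually.of_forall huS) fun y hy hcl => ?_
  obtain ⟨φ, hφ, hlim⟩ := hcl.tendsto_subseq
  have hAu := (hA.tendsto y).comp hlim
  have hBu := (hB.tendsto y).comp hlim
  have hCu := (hC.tendsto y).comp hlim
  have hinv : Tendsto (fun n => ((φ n : ℝ) + 1)⁻¹) atTop (𝓝 0) := by
    simpa [Function.comp_def] using
      (tendsto_one_div_add_atTop_nhds_zero_nat (𝕜 := ℝ)).comp hφ.tendsto_atTop
  have key : ∀ n, A (u (φ n)) + ((φ n : ℝ) + 1) * B (u (φ n)) + ((φ n : ℝ) + 1)⁻¹ * C (u (φ n)) ≤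
      A q + ((φ n : ℝ) + 1)⁻¹ * C q := fun n => by
    simpa [hBq] using hu (φ n) hq
  -- Dividing `key` by the penalty weight forces `B y = 0` at a cluster point; dropping the penalty
  -- gives `A y ≤ A q`.
  refine huniq y hy (le_antisymm ?_ (hB0 y)) ?_
  · have hr : Tendsto (fun n => ((φ n : ℝ) + 1)⁻¹ *
        (A q - A (u (φ n)) + ((φ n : ℝ) + 1)⁻¹ * (C q - C (u (φ n))))) atTop (𝓝 0) := by
      simpa using hinv.mul ((hAu.const_sub (A q)).add (hinv.mul (hCu.const_sub (C q))))
    refine le_of_tendsto_of_tendsto' hBu hr fun n => ?_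
    have hp : (0 : ℝ) < (φ n : ℝ) + 1 := by positivity
    rw [inv_mul_eq_div, le_div_iff₀ hp]
    have := key n
    simp only [Function.comp]
    linarith
  · have hr : Tendsto (fun n => A q + ((φ n : ℝ) + 1)⁻¹ * (C q - C (u (φ n)))) atTop
        (𝓝 (A q)) := by
      simpa using (hinv.mul (hCu.const_sub (C q))).const_add (A q)
    refine le_of_tendsto_of_tendsto' hAu hr fun n => ?_
    have hp : 0 ≤ ((φ n : ℝ) + 1) * B (u (φ n)) := mul_nonneg (by positivity) (hB0 _)
    have := key n
    simp only [Function.comp]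
    linarith

/-! ### Stationarity of the decoupled objective in each variable -/

section Decoupling

variable {V ι : Type*} [NormedAddCommGroup V] [Fintype ι]

/-- The penalized objective in which each constraint `F i ≤ c i + β i * t` has its own copy `y i`
of the variable `x`; the weight `N` ties the copies together. -/
noncomputable def decoupledObjective (F : ι → V → ℝ) (c β : ι → ℝ) (x₀ z : V) (w : ι → ℝ) (N : ℝ)
    (q : ℝ × V × (ι → V)) : ℝ :=
  q.1 + ‖q.2.1 - x₀‖ ^ 2 / 2 + ‖q.2.1 - z‖ ^ 2 / 2 +
    ∑ i, (w i * quadPenalty (F i (q.2.2 i) - c i - β i * q.1) + N⁻¹ * F i (q.2.2 i) +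
      N * (‖q.2.2 i - q.2.1‖ ^ 2 / 2))

variable {F : ι → V → ℝ} {c β w : ι → ℝ} {x₀ z x : V} {N t : ℝ} {y : ι → V}

/-- With the other variables frozen, only the `i`-th summand depends on the copy `y i`. -/
lemma isLocalMin_copy
    (hmin : IsLocalMin (decoupledObjective F c β x₀ z w N) (t, x, y)) (i : ι) :
    IsLocalMin (fun v => (w i * quadPenalty (F i v - c i - β i * t) + N⁻¹ * F i v) +
      N * (‖v - x‖ ^ 2 / 2)) (y i) := by
  classical
  have hc : Continuous (fun v : V => ((t, x, Function.update y i v) : ℝ × V × (ι → V))) := by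
    fun_prop
  have ht : Tendsto (fun v : V => ((t, x, Function.update y i v) : ℝ × V × (ι → V)))
      (𝓝 (y i)) (𝓝 (t, x, y)) := by
    simpa using hc.tendsto (y i)
  filter_upwards [ht.eventually hmin] with v hv
  simp only [decoupledObjective] at hv
  have hrest : ∀ j ∈ Finset.univ.erase i, Function.update y i v j = y j := fun j hj =>
    Function.update_of_ne (Finset.ne_of_mem_erase hj) _ _
  have hsum := Finset.sum_congr (rfl : Finset.univ.erase i = Finset.univ.erase i) fun j hj =>
    congrArg (fun a => w j * quadPenalty (F j a - c j - β j * t) + N⁻¹ * F j a +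
      N * (‖a - x‖ ^ 2 / 2)) (hrest j hj)
  rw [← Finset.add_sum_erase _ _ (Finset.mem_univ i),
    ← Finset.add_sum_erase _ _ (Finset.mem_univ i), hsum] at hv
  simp only [Function.update_self] at hv
  linarith

/-- This is the vanishing derivative in `t`; it normalizes the multipliers. -/
lemma sum_eq_one_of_isLocalMin
    (hmin : IsLocalMin (decoupledObjective F c β x₀ z w N) (t, x, y)) :
    ∑ i, β i * (w i * max (F i (y i) - c i - β i * t) 0) = 1 := by
  have hc : Continuous (fun s : ℝ => ((s, x, y) : ℝ × V × (ι → V))) := by fun_prop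
  have hloc : IsLocalMin (fun s : ℝ => decoupledObjective F c β x₀ z w N (s, x, y)) t :=
    (hc.tendsto t).eventually hmin
  have hterm : ∀ i, HasDerivAt (fun s : ℝ =>
      w i * quadPenalty (F i (y i) - c i - β i * s) + N⁻¹ * F i (y i) +
        N * (‖y i - x‖ ^ 2 / 2)) (w i * (max (F i (y i) - c i - β i * t) 0 * (-β i))) t := by
    intro i
    have h1 : HasDerivAt (fun s : ℝ => F i (y i) - c i - β i * s) (-β i) t := by
      simpa using ((hasDerivAt_id t).const_mul (β i)).const_sub (F i (y i) - c i)
    exact (((HasDerivAt.comp t (hasDerivAt_quadPenalty _) h1).const_mul (w i)).add_const _).add_const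
      _
  have hd : HasDerivAt (fun s : ℝ => decoupledObjective F c β x₀ z w N (s, x, y))
      (1 + ∑ i, w i * (max (F i (y i) - c i - β i * t) 0 * (-β i))) t :=
    HasDerivAt.add (((hasDerivAt_id t).add_const (‖x - x₀‖ ^ 2 / 2)).add_const
      (‖x - z‖ ^ 2 / 2)) (HasDerivAt.fun_sum fun i _ => hterm i)
  have h0 := hloc.hasDerivAt_eq_zero hd
  have e : ∑ i, w i * (max (F i (y i) - c i - β i * t) 0 * (-β i)) =
      -∑ i, β i * (w i * max (F i (y i) - c i - β i * t) 0) := by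
    rw [← Finset.sum_neg_distrib]
    exact Finset.sum_congr rfl fun i _ => by ring
  rw [e] at h0
  linarith

variable [InnerProductSpace ℝ V]

/-- This is the vanishing gradient in the shared variable `x`, which enters only through smooth
quadratic terms. -/
lemma sum_smul_eq_of_isLocalMin
    (hmin : IsLocalMin (decoupledObjective F c β x₀ z w N) (t, x, y)) :
    ∑ i, N • (x - y i) + (x - x₀) + (x - z) = 0 := by
  have hc : Continuous (fun v : V => ((t, v, y) : ℝ × V × (ι → V))) := by fun_prop
  have hloc : IsLocalMin (fun v : V => decoupledObjective F c β x₀ z w N (t, v, y)) x :=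
    (hc.tendsto x).eventually hmin
  have hsq : ∀ a : V, HasFDerivAt (fun v : V => ‖v - a‖ ^ 2 / 2) (innerSL ℝ (x - a)) x := by
    intro a
    have h1 : HasFDerivAt (fun v : V => v - a) (ContinuousLinearMap.id ℝ V) x :=
      (hasFDerivAt_id x).sub_const a
    refine ((h1.norm_sq.mul_const (2⁻¹ : ℝ)).congr_fderiv ?_).congr_of_eventuallyEq
      (Eventually.of_forall fun v => by simp [div_eq_mul_inv])
    ext v
    simp
  have hd : HasFDerivAt (fun v : V => decoupledObjective F c β x₀ z w N (t, v, y))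
      (innerSL ℝ (x - x₀) + innerSL ℝ (x - z) + ∑ i, N • innerSL ℝ (x - y i)) x := by
    refine (((hsq x₀).const_add t).add (hsq z)).add (HasFDerivAt.fun_sum fun i _ => ?_)
    simp only [norm_sub_rev (y i)]
    exact ((hsq (y i)).const_mul N).const_add _
  have h0 := hloc.hasFDerivAt_eq_zero hd
  refine ext_inner_right ℝ fun v => ?_
  have := DFunLike.congr_fun h0 v
  simp only [add_apply, innerSL_apply_apply, sum_apply,
    smul_apply, zero_apply, smul_eq_mul] at this
  simp only [inner_add_left, sum_inner, inner_smul_left, inner_zero_left, RCLike.conj_to_real]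
  linarith

end Decoupling

/-! ### Passage to the limit and the multiplier rule -/

section Multipliers

variable {V ι : Type*} [NormedAddCommGroup V] [InnerProductSpace ℝ V] [Fintype ι]

lemma mem_limitingSubdifferential_of_tendsto {F : V → ℝ} (hF : Continuous F) {z ξ : V}
    {y ξ' : ℕ → V} (hy : Tendsto y atTop (𝓝 z)) (hξ : Tendsto ξ' atTop (𝓝 ξ))
    (h : ∀ k, ∀ ε : ℝ, 0 < ε → WithLp.toLp 2 (ξ' k, (-1 : ℝ)) ∈
      epsNormals ε (WithLp.toLp 2 (y k, F (y k))) (epigraph F)) :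
    ξ ∈ limitingSubdifferential F z := by
  refine ⟨fun k => WithLp.toLp 2 (y k, F (y k)), fun k => 1 / ((k : ℝ) + 1),
    fun k => WithLp.toLp 2 (ξ' k, (-1 : ℝ)), fun k => le_refl (F (y k)), ?_, fun k => by positivity,
    tendsto_one_div_add_atTop_nhds_zero_nat, ?_, fun k => h k _ (by positivity)⟩
  · exact ((WithLp.prod_continuous_toLp 2 V ℝ).tendsto _).comp
      (hy.prodMk_nhds ((hF.tendsto z).comp hy))
  · exact ((WithLp.prod_continuous_toLp 2 V ℝ).tendsto _).comp
      (hξ.prodMk_nhds tendsto_const_nhds)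

/-- First-order conditions at a minimizer of the decoupled problem. -/
lemma exists_approximate_multipliers {F : ι → V → ℝ} {c β w : ι → ℝ} {x₀ z x : V} {N t : ℝ}
    {y : ι → V} (hw : ∀ i, 0 ≤ w i) (hN : 0 < N)
    (hmin : IsLocalMin (decoupledObjective F c β x₀ z w N) (t, x, y)) :
    ∃ (d : ι → ℝ) (ξ : ι → V), (∀ i, 0 < d i) ∧
      (∀ i, d i = w i * max (F i (y i) - c i - β i * t) 0 + N⁻¹) ∧
      (∀ i, ∀ ε : ℝ, 0 < ε → WithLp.toLp 2 (ξ i, (-1 : ℝ)) ∈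
        epsNormals ε (WithLp.toLp 2 (y i, F i (y i))) (epigraph (F i))) ∧
      (∀ i, ∀ K : NNReal, ∀ U ∈ 𝓝 (y i), LipschitzOnWith K (F i) U → ‖ξ i‖ ≤ K) ∧
      ∑ i, β i * (d i - N⁻¹) = 1 ∧ ∑ i, d i • ξ i + (x - x₀) + (x - z) = 0 := by
  -- The term `N⁻¹ * F i` in the objective contributes `N⁻¹`. It keeps `d i` positive when the
  -- penalty is inactive, so that a subgradient exists for every `i`, and it disappears in the
  -- limit.
  set d : ι → ℝ := fun i => w i * max (F i (y i) - c i - β i * t) 0 + N⁻¹ with hd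
  have hdpos : ∀ i, 0 < d i := fun i => by
    have := mul_nonneg (hw i) (le_max_right (F i (y i) - c i - β i * t) 0)
    simp only [hd]
    positivity
  have hmono : ∀ i, Monotone
      (fun s : ℝ => w i * quadPenalty (s - c i - β i * t) + N⁻¹ * s) := fun i a b hab => by
    have := quadPenalty_mono (show a - c i - β i * t ≤ b - c i - β i * t by linarith)
    have := hw i
    dsimp only
    gcongr
  have hderiv : ∀ i, HasDerivAt
      (fun s : ℝ => w i * quadPenalty (s - c i - β i * t) + N⁻¹ * s) (d i) (F i (y i)) := by
    intro i
    have h1 : HasDerivAt (fun s : ℝ => s - c i - β i * t) 1 (F i (y i)) :=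
      ((hasDerivAt_id _).sub_const (c i)).sub_const (β i * t)
    have h2 := (HasDerivAt.comp (F i (y i)) (hasDerivAt_quadPenalty _) h1).const_mul (w i)
    have h3 := h2.add ((hasDerivAt_id (F i (y i))).const_mul N⁻¹)
    rw [mul_one, mul_one] at h3
    exact h3
  refine ⟨d, fun i => (N / d i) • (x - y i), hdpos, fun i => rfl,
    fun i ε hε => mem_epsNormals_epigraph_of_isLocalMin (hmono i) (hdpos i) (hderiv i)
      (isLocalMin_copy hmin i) hε,
    fun i K U hU hK => norm_le_of_isLocalMin hU hK (hmono i) (hdpos i) hN (hderiv i)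
      (isLocalMin_copy hmin i), ?_, ?_⟩
  · simpa [hd] using sum_eq_one_of_isLocalMin hmin
  · rw [← sum_smul_eq_of_isLocalMin hmin]
    congr 2
    refine Finset.sum_congr rfl fun i _ => ?_
    rw [smul_smul, mul_div_cancel₀ _ (hdpos i).ne']

/-- Minimizers of the decoupled problems converge to a local minimizer of the original one. -/
lemma exists_decoupled_minimizers [FiniteDimensional ℝ V] {F : ι → V → ℝ}
    (hF : ∀ i, Continuous (F i)) {c α β : ι → ℝ} (hβ : ∀ i, 0 ≤ β i)
    (hαβ : ∀ i, α i * β i = 0) {x₀ z : V} {t : ℝ}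
    (hmin : IsLocalMinOn (fun q : ℝ × V => q.1 +
      ∑ i, α i * quadPenalty (F i q.2 - c i - β i * q.1) + ‖q.2 - x₀‖ ^ 2 / 2)
      {q | ∀ i, β i * quadPenalty (F i q.2 - c i - β i * q.1) = 0} (t, z))
    (hz : ∀ i, β i * quadPenalty (F i z - c i - β i * t) = 0) :
    ∃ u : ℕ → ℝ × V × (ι → V), Tendsto u atTop (𝓝 (t, z, fun _ => z)) ∧
      ∀ᶠ n : ℕ in atTop, IsLocalMin
        (decoupledObjective F c β x₀ z (fun i => α i + ((n : ℝ) + 1) * β i) ((n : ℝ) + 1)) (u n) := by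
  obtain ⟨W, hW, hWmin⟩ := mem_nhdsWithin_iff_exists_mem_nhds_inter.1 hmin
  obtain ⟨δ, hδ, hδW⟩ := Metric.nhds_basis_closedBall.mem_iff.1 hW
  -- The term `‖x - z‖ ^ 2 / 2` turns the local minimizer into one with a unique `x`-component
  -- without affecting the gradient at `z`.
  let A : ℝ × V × (ι → V) → ℝ := fun q => q.1 +
    ∑ i, α i * quadPenalty (F i (q.2.2 i) - c i - β i * q.1) + ‖q.2.1 - x₀‖ ^ 2 / 2 +
      ‖q.2.1 - z‖ ^ 2 / 2
  let B : ℝ × V × (ι → V) → ℝ := fun q =>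
    ∑ i, (β i * quadPenalty (F i (q.2.2 i) - c i - β i * q.1) + ‖q.2.2 i - q.2.1‖ ^ 2 / 2)
  let C : ℝ × V × (ι → V) → ℝ := fun q => ∑ i, F i (q.2.2 i)
  have hqp := continuous_quadPenalty
  have hA : Continuous A := by fun_prop
  have hB : Continuous B := by fun_prop
  have hC : Continuous C := by fun_prop
  have hobj : ∀ (N : ℝ) q, A q + N * B q + N⁻¹ * C q =
      decoupledObjective F c β x₀ z (fun i => α i + N * β i) N q := by
    intro N q
    simp only [A, B, C, decoupledObjective, Finset.mul_sum, mul_add, add_mul,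
      Finset.sum_add_distrib, mul_assoc]
    ring
  let q₀ : ℝ × V × (ι → V) := (t, z, fun _ => z)
  let S : Set (ℝ × V × (ι → V)) := Metric.closedBall q₀ δ
  have hS : IsCompact S := isCompact_closedBall _ _
  have hq₀ : q₀ ∈ S := Metric.mem_closedBall_self hδ.le
  have hex : ∀ n : ℕ, ∃ q ∈ S,
      IsMinOn (fun y => A y + ((n : ℝ) + 1) * B y + ((n : ℝ) + 1)⁻¹ * C y) S q := fun n =>
    hS.exists_isMinOn ⟨q₀, hq₀⟩ (by fun_prop)
  choose u huS hu using hex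
  have hterm : ∀ (q : ℝ × V × (ι → V)) i, 0 ≤ β i *
      quadPenalty (F i (q.2.2 i) - c i - β i * q.1) :=
    fun q i => mul_nonneg (hβ i) (quadPenalty_nonneg _)
  have hlim : Tendsto u atTop (𝓝 q₀) := by
    refine tendsto_of_penalty_minimizers hS hA hB hC (fun q => Finset.sum_nonneg fun i _ =>
      add_nonneg (hterm q i) (by positivity)) hq₀ (by simp [B, q₀, hz]) ?_ huS hu
    rintro ⟨s, x, y⟩ hq hBq hAq
    have hBi := (Finset.sum_eq_zero_iff_of_nonneg fun i _ =>
      add_nonneg (hterm (s, x, y) i) (by positivity)).1 hBq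
    have hy : y = fun _ => x := funext fun i => by
      have h1 := hBi i (Finset.mem_univ i)
      have h2 := hterm (s, x, y) i
      have h3 : ‖y i - x‖ ^ 2 = 0 := by
        have := sq_nonneg ‖y i - x‖
        dsimp only at h1 h2
        linarith
      simpa [sub_eq_zero] using h3
    subst hy
    have hfeas : ∀ i, β i * quadPenalty (F i x - c i - β i * s) = 0 := fun i => by
      simpa using hBi i (Finset.mem_univ i)
    have hball : (s, x) ∈ Metric.closedBall (t, z) δ := by
      simp only [S, q₀, Metric.mem_closedBall, Prod.dist_eq, max_le_iff] at hq ⊢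
      exact ⟨hq.1, hq.2.1⟩
    have hle := hWmin ⟨hδW hball, hfeas⟩
    simp only [Set.mem_ofPred_eq] at hle
    simp only [A, q₀, sub_self, norm_zero] at hAq
    have hx : x = z := by
      have : ‖x - z‖ ^ 2 = 0 := by
        have := sq_nonneg ‖x - z‖
        linarith
      simpa [sub_eq_zero] using this
    subst hx
    -- Fixed-weight penalties (`α i ≠ 0`) have `β i = 0` and so do not see the value of `t`; hence
    -- comparing objective values isolates `s = t`.
    have hα : ∀ i, α i * quadPenalty (F i x - c i - β i * s) =
        α i * quadPenalty (F i x - c i - β i * t) := fun i => by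
      rcases mul_eq_zero.1 (hαβ i) with h | h <;> simp [h]
    simp only [hα, sub_self, norm_zero] at hAq hle
    have : s = t := by linarith
    rw [this]
  refine ⟨u, hlim, ?_⟩
  filter_upwards [hlim.eventually (eventually_mem_nhds_iff.2 (Metric.closedBall_mem_nhds q₀ hδ))]
    with n hn
  have := (hu n).isLocalMin hn
  simpa only [hobj] using this

/-- The Lagrange multiplier rule for a local minimizer of a penalized problem. -/
theorem exists_multipliers [FiniteDimensional ℝ V] {F : ι → V → ℝ}
    (hF : ∀ i, LocallyLipschitz (F i)) {c α β : ι → ℝ} (hα : ∀ i, 0 ≤ α i) (hβ : ∀ i, 0 ≤ β i)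
    (hαβ : ∀ i, α i * β i = 0) {x₀ z : V} {t : ℝ}
    (hmin : IsLocalMinOn (fun q : ℝ × V => q.1 +
      ∑ i, α i * quadPenalty (F i q.2 - c i - β i * q.1) + ‖q.2 - x₀‖ ^ 2 / 2)
      {q | ∀ i, β i * quadPenalty (F i q.2 - c i - β i * q.1) = 0} (t, z))
    (hz : ∀ i, β i * quadPenalty (F i z - c i - β i * t) = 0) :
    ∃ (d : ι → ℝ) (ξ : ι → V), (∀ i, 0 ≤ d i) ∧
      (∀ i, ξ i ∈ limitingSubdifferential (F i) z) ∧ ∑ i, β i * d i = 1 ∧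
      (∀ i, β i = 0 → d i = α i * max (F i z - c i) 0) ∧
      ∑ i, d i • ξ i + (z - x₀) = 0 := by
  have hFc : ∀ i, Continuous (F i) := fun i => (hF i).continuous
  obtain ⟨u, hu, hloc⟩ := exists_decoupled_minimizers hFc hβ hαβ hmin hz
  have hut : Tendsto (fun n => (u n).1) atTop (𝓝 t) := (continuous_fst.tendsto _).comp hu
  have hux : Tendsto (fun n => (u n).2.1) atTop (𝓝 z) :=
    ((continuous_fst.comp continuous_snd).tendsto _).comp hu
  have huy : ∀ i, Tendsto (fun n => (u n).2.2 i) atTop (𝓝 z) := fun i =>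
    (((continuous_apply i).comp (continuous_snd.comp continuous_snd)).tendsto _).comp hu
  have hinv : Tendsto (fun n : ℕ => ((n : ℝ) + 1)⁻¹) atTop (𝓝 0) := by
    simpa using tendsto_one_div_add_atTop_nhds_zero_nat (𝕜 := ℝ)
  -- Minimality is only eventual in `n`, so it is a premise here and the multipliers take the
  -- default value zero otherwise.
  have hex : ∀ n : ℕ, ∃ (d : ι → ℝ) (ξ : ι → V), IsLocalMin
      (decoupledObjective F c β x₀ z (fun i => α i + ((n : ℝ) + 1) * β i) ((n : ℝ) + 1)) (u n) →
      (∀ i, 0 < d i) ∧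
      (∀ i, d i = (α i + ((n : ℝ) + 1) * β i) *
        max (F i ((u n).2.2 i) - c i - β i * (u n).1) 0 + ((n : ℝ) + 1)⁻¹) ∧
      (∀ i, ∀ ε : ℝ, 0 < ε → WithLp.toLp 2 (ξ i, (-1 : ℝ)) ∈
        epsNormals ε (WithLp.toLp 2 ((u n).2.2 i, F i ((u n).2.2 i))) (epigraph (F i))) ∧
      (∀ i, ∀ K : NNReal, ∀ U ∈ 𝓝 ((u n).2.2 i), LipschitzOnWith K (F i) U → ‖ξ i‖ ≤ K) ∧
      ∑ i, β i * (d i - ((n : ℝ) + 1)⁻¹) = 1 ∧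
      ∑ i, d i • ξ i + ((u n).2.1 - x₀) + ((u n).2.1 - z) = 0 := by
    intro n
    by_cases hn : IsLocalMin
      (decoupledObjective F c β x₀ z (fun i => α i + ((n : ℝ) + 1) * β i) ((n : ℝ) + 1)) (u n)
    · obtain ⟨d, ξ, h⟩ := exists_approximate_multipliers
        (fun i => add_nonneg (hα i) (mul_nonneg (by positivity) (hβ i))) (by positivity) hn
      exact ⟨d, ξ, fun _ => h⟩
    · exact ⟨0, 0, fun h => absurd h hn⟩
  choose d ξ hdξ using hex
  replace hdξ := hloc.mono fun n hn => hdξ n hn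
  have hlimβ : ∀ i, β i = 0 → Tendsto (fun n => d n i) atTop (𝓝 (α i * max (F i z - c i) 0)) := by
    intro i hi
    have h1 : Tendsto (fun n : ℕ => α i * max (F i ((u n).2.2 i) - c i) 0 + ((n : ℝ) + 1)⁻¹) atTop
        (𝓝 (α i * max (F i z - c i) 0 + 0)) :=
      ((((((hFc i).tendsto z).comp (huy i)).sub_const (c i)).max tendsto_const_nhds).const_mul
        (α i)).add hinv
    rw [add_zero] at h1
    refine h1.congr' ?_
    filter_upwards [hdξ] with n hn
    rw [hn.2.1 i, hi]
    simp
  have hbound : ∀ i, ∃ D, ∀ᶠ n in atTop, d n i ≤ D := by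
    intro i
    rcases (hβ i).eq_or_lt with hi | hi
    · exact ⟨_, (hlimβ i hi.symm).eventually_le_const (lt_add_one _)⟩
    -- All terms of the normalized sum are nonnegative, so each is at most `1`; the extra `1`
    -- absorbs `(n + 1)⁻¹`.
    · refine ⟨1 / β i + 1, ?_⟩
      filter_upwards [hdξ] with n ⟨_, hn2, _, _, hn5, _⟩
      have hle : β i * (d n i - ((n : ℝ) + 1)⁻¹) ≤ 1 := by
        refine le_trans ?_ hn5.le
        refine Finset.single_le_sum (f := fun i => β i * (d n i - ((n : ℝ) + 1)⁻¹))
          (fun j _ => mul_nonneg (hβ j) ?_) (Finset.mem_univ i)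
        rw [hn2 j, add_sub_cancel_right]
        exact mul_nonneg (add_nonneg (hα j) (mul_nonneg (by positivity) (hβ j))) (le_max_right _ _)
      have h1 : d n i - ((n : ℝ) + 1)⁻¹ ≤ 1 / β i := by
        rw [le_div_iff₀ hi]; linarith
      have h2 : ((n : ℝ) + 1)⁻¹ ≤ 1 := inv_le_one_of_one_le₀ (by simp)
      linarith
  choose D hD using hbound
  choose K U hU hK using fun i => hF i z
  have hcomp : IsCompact ((Set.univ.pi fun i => Set.Icc 0 (D i)) ×ˢ
      (Set.univ.pi fun i => Metric.closedBall (0 : V) (K i))) :=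
    (isCompact_univ_pi fun i => isCompact_Icc).prod
      (isCompact_univ_pi fun i => isCompact_closedBall _ _)
  have hmem : ∀ᶠ n in atTop, (d n, ξ n) ∈ (Set.univ.pi fun i => Set.Icc 0 (D i)) ×ˢ
      (Set.univ.pi fun i => Metric.closedBall (0 : V) (K i)) := by
    filter_upwards [hdξ, eventually_all.2 hD, eventually_all.2 fun i =>
      (huy i).eventually (eventually_mem_nhds_iff.2 (hU i))] with n hn hnD hnU
    exact ⟨fun i _ => ⟨(hn.1 i).le, hnD i⟩, fun i _ => by
      simpa using hn.2.2.2.1 i _ _ (hnU i) (hK i)⟩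
  obtain ⟨⟨d', ξ'⟩, hmem', φ, hφ, hlim⟩ := hcomp.tendsto_subseq' hmem.frequently
  have hd' : ∀ i, Tendsto (fun n => d (φ n) i) atTop (𝓝 (d' i)) := fun i =>
    (((continuous_apply i).comp continuous_fst).tendsto _).comp hlim
  have hξ' : ∀ i, Tendsto (fun n => ξ (φ n) i) atTop (𝓝 (ξ' i)) := fun i =>
    (((continuous_apply i).comp continuous_snd).tendsto _).comp hlim
  have hφt := hφ.tendsto_atTop
  have hgood := hφt.eventually hdξ
  refine ⟨d', ξ', fun i => (hmem'.1 i trivial).1, fun i => ?_, ?_, fun i hi => ?_, ?_⟩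
  -- The definition of the limiting cone asks for normals at every index, so the first `m` terms are
  -- dropped.
  · obtain ⟨m, hm⟩ := eventually_atTop.1 hgood
    refine mem_limitingSubdifferential_of_tendsto (hFc i)
      (((huy i).comp hφt).comp (tendsto_add_atTop_nat m))
      ((hξ' i).comp (tendsto_add_atTop_nat m)) fun k ε hε => ?_
    exact (hm (k + m) (Nat.le_add_left m k)).2.2.1 i ε hε
  · have h1 : Tendsto (fun n => ∑ i, β i * (d (φ n) i - ((φ n : ℝ) + 1)⁻¹)) atTop
        (𝓝 (∑ i, β i * (d' i - 0))) :=
      tendsto_finsetSum _ fun i _ => ((hd' i).sub (hinv.comp hφt)).const_mul (β i)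
    simp only [sub_zero] at h1
    refine tendsto_nhds_unique h1 (tendsto_const_nhds.congr' ?_)
    filter_upwards [hgood] with n hn
    exact hn.2.2.2.2.1.symm
  · exact tendsto_nhds_unique (hd' i) ((hlimβ i hi).comp hφt)
  · have h1 : Tendsto (fun n => ∑ i, d (φ n) i • ξ (φ n) i + ((u (φ n)).2.1 - x₀) +
        ((u (φ n)).2.1 - z)) atTop (𝓝 (∑ i, d' i • ξ' i + (z - x₀) + (z - z))) :=
      ((tendsto_finsetSum _ fun i _ => (hd' i).smul (hξ' i)).add
        ((hux.comp hφt).sub_const x₀)).add ((hux.comp hφt).sub_const z)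
    rw [sub_self, add_zero] at h1
    refine tendsto_nhds_unique h1 (tendsto_const_nhds.congr' ?_)
    filter_upwards [hgood] with n hn
    exact hn.2.2.2.2.2.symm

end Multipliers

/-! ### Penalizing part of the constraints -/

/-- Minimizers of the problems in which the constraints with `γ i ≠ 0` are penalized. -/
lemma exists_penalty_minimizers {V ι : Type*} [NormedAddCommGroup V] [InnerProductSpace ℝ V]
    [FiniteDimensional ℝ V] [Fintype ι] {F : ι → V → ℝ} (hF : ∀ i, Continuous (F i))
    {c β γ : ι → ℝ} (hγ : ∀ i, 0 ≤ γ i) (hβγ : ∀ i, β i ≠ 0 ∨ γ i ≠ 0) {x₀ : V}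
    (hx₀ : ∀ i, F i x₀ ≤ c i)
    (hopt : ∀ᶠ x in 𝓝 x₀, ∀ t, (∀ i, F i x ≤ c i + β i * t) → 0 ≤ t) :
    ∃ (t : ℕ → ℝ) (x : ℕ → V), Tendsto x atTop (𝓝 x₀) ∧
      (∀ n i, β i * quadPenalty (F i (x n) - c i - β i * t n) = 0) ∧
      (∀ n : ℕ, t n +
        ∑ i, ((n : ℝ) + 1) * γ i * quadPenalty (F i (x n) - c i - β i * t n) ≤ 0) ∧
      ∀ᶠ n : ℕ in atTop, IsLocalMinOn (fun q : ℝ × V => q.1 +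
        ∑ i, ((n : ℝ) + 1) * γ i * quadPenalty (F i q.2 - c i - β i * q.1) + ‖q.2 - x₀‖ ^ 2 / 2)
        {q | ∀ i, β i * quadPenalty (F i q.2 - c i - β i * q.1) = 0} (t n, x n) := by
  obtain ⟨δ, hδ, hδopt⟩ := Metric.nhds_basis_closedBall.eventually_iff.1 hopt
  let A : ℝ × V → ℝ := fun q => q.1 + ‖q.2 - x₀‖ ^ 2 / 2
  let B : ℝ × V → ℝ := fun q => ∑ i, γ i * quadPenalty (F i q.2 - c i - β i * q.1)
  let T : Set (ℝ × V) := {q | ∀ i, β i * quadPenalty (F i q.2 - c i - β i * q.1) = 0}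
  have hqp := continuous_quadPenalty
  have hA : Continuous A := by fun_prop
  have hB : Continuous B := by fun_prop
  have hT : IsClosed T := by
    simp only [T, Set.ofPred_forall]
    exact isClosed_iInter fun i => isClosed_eq (by fun_prop) continuous_const
  let q₀ : ℝ × V := (0, x₀)
  let S : Set (ℝ × V) := Metric.closedBall q₀ δ ∩ T
  have hS : IsCompact S := (isCompact_closedBall _ _).inter_right hT
  have hpen₀ : ∀ i, quadPenalty (F i x₀ - c i) = 0 := fun i => by
    rw [quadPenalty_eq_zero_iff]
    linarith [hx₀ i]
  have hq₀ : q₀ ∈ S := ⟨Metric.mem_closedBall_self hδ.le, fun i => by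
    simp only [q₀, mul_zero, sub_zero, hpen₀]⟩
  -- The zero summand matches the form of `tendsto_of_penalty_minimizers`, with `C = 0`.
  have hex : ∀ n : ℕ, ∃ q ∈ S,
      IsMinOn (fun y => A y + ((n : ℝ) + 1) * B y + ((n : ℝ) + 1)⁻¹ * 0) S q := fun n =>
    hS.exists_isMinOn ⟨q₀, hq₀⟩ (by fun_prop)
  choose u huS hu using hex
  have hterm : ∀ (q : ℝ × V) i, 0 ≤ γ i * quadPenalty (F i q.2 - c i - β i * q.1) :=
    fun q i => mul_nonneg (hγ i) (quadPenalty_nonneg _)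
  have hB₀ : B q₀ = 0 := by simp only [B, q₀, mul_zero, sub_zero, hpen₀, Finset.sum_const_zero]
  have hA₀ : A q₀ = 0 := by simp [A, q₀]
  have hlim : Tendsto u atTop (𝓝 q₀) := by
    refine tendsto_of_penalty_minimizers hS hA hB continuous_const
      (fun q => Finset.sum_nonneg fun i _ => hterm q i) hq₀ hB₀ ?_ huS hu
    rintro ⟨t, x⟩ ⟨hball, hq⟩ hBq hAq
    have hBi := (Finset.sum_eq_zero_iff_of_nonneg fun i _ => hterm (t, x) i).1 hBq
    have hle : ∀ i, F i x ≤ c i + β i * t := fun i => by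
      have h0 : quadPenalty (F i x - c i - β i * t) = 0 := by
        rcases hβγ i with h | h
        · exact (mul_eq_zero.1 (hq i)).resolve_left h
        · exact (mul_eq_zero.1 (hBi i (Finset.mem_univ i))).resolve_left h
      linarith [quadPenalty_eq_zero_iff.1 h0]
    have hxb : x ∈ Metric.closedBall x₀ δ := by
      simp only [q₀, Metric.mem_closedBall, Prod.dist_eq, max_le_iff] at hball ⊢
      exact hball.2
    have ht := hδopt hxb t hle
    rw [hA₀] at hAq
    have hn := sq_nonneg ‖x - x₀‖
    simp only [A] at hAq
    have hx : ‖x - x₀‖ ^ 2 = 0 := by linarith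
    have ht0 : t = 0 := by linarith
    have hx' : x = x₀ := by simpa [sub_eq_zero] using hx
    rw [ht0, hx']
  have hobj : ∀ (n : ℕ) q, A q + ((n : ℝ) + 1) * B q + ((n : ℝ) + 1)⁻¹ * 0 = q.1 +
      ∑ i, ((n : ℝ) + 1) * γ i * quadPenalty (F i q.2 - c i - β i * q.1) +
        ‖q.2 - x₀‖ ^ 2 / 2 := by
    intro n q
    simp only [A, B, Finset.mul_sum, mul_assoc]
    ring
  refine ⟨fun n => (u n).1, fun n => (u n).2, (continuous_snd.tendsto _).comp hlim,
    fun n => (huS n).2, fun n => ?_, ?_⟩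
  · have h1 : A (u n) + ((n : ℝ) + 1) * B (u n) + ((n : ℝ) + 1)⁻¹ * 0 ≤
        A q₀ + ((n : ℝ) + 1) * B q₀ + ((n : ℝ) + 1)⁻¹ * 0 := hu n hq₀
    rw [hobj, hA₀, hB₀] at h1
    have := sq_nonneg ‖(u n).2 - x₀‖
    linarith
  · filter_upwards [hlim.eventually (eventually_mem_nhds_iff.2 (Metric.closedBall_mem_nhds q₀ hδ))]
      with n hn
    filter_upwards [nhdsWithin_le_nhds hn, self_mem_nhdsWithin] with q hq hqT
    have := hu n ⟨hq, hqT⟩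
    simpa only [Set.mem_ofPred_eq, hobj] using this

/-! ### The multiobjective problem -/

section Problem

variable {n p m r : ℕ}

/-- Objectives, inequality constraints, and each equality as a pair of inequalities. -/
def problemFamily (f : Fin p → EuclideanSpace ℝ (Fin n) → ℝ)
    (g : Fin m → EuclideanSpace ℝ (Fin n) → ℝ) (h : Fin r → EuclideanSpace ℝ (Fin n) → ℝ) :
    Fin p ⊕ Fin m ⊕ Fin r ⊕ Fin r → EuclideanSpace ℝ (Fin n) → ℝ :=
  Sum.elim f (Sum.elim g (Sum.elim h fun j y => -h j y))

lemma max_mul_self_eq (s : ℝ) : max s 0 * s = 2 * quadPenalty s := by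
  rcases le_total s 0 with hs | hs <;> simp [quadPenalty, hs]
  ring

lemma sq_eq_quadPenalty_add (s : ℝ) : s ^ 2 = 2 * (quadPenalty s + quadPenalty (-s)) := by
  rcases le_total s 0 with hs | hs <;> simp [quadPenalty, hs] <;> ring

/-- Penalty minimizers with multipliers of the form `N * max (g i x) 0` and `N * |h j x|`. -/
lemma exists_akkt_sequence {f : Fin p → EuclideanSpace ℝ (Fin n) → ℝ}
    {g : Fin m → EuclideanSpace ℝ (Fin n) → ℝ} {h : Fin r → EuclideanSpace ℝ (Fin n) → ℝ}
    (hf : ∀ l, LocallyLipschitz (f l)) (hg : ∀ i, LocallyLipschitz (g i))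
    (hh : ∀ j, LocallyLipschitz (h j)) {x₀ : EuclideanSpace ℝ (Fin n)}
    (hx₀ : IsLocalWeakEfficient f g h x₀) :
    ∃ x : ℕ → EuclideanSpace ℝ (Fin n), Tendsto x atTop (𝓝 x₀) ∧
      (∀ (k : ℕ) l, f l (x k) - f l x₀ +
        ((k : ℝ) + 1) / 2 * (∑ i, max (g i (x k)) 0 * g i (x k) + ∑ j, h j (x k) ^ 2) ≤ 0) ∧
      ∀ᶠ k : ℕ in atTop, ∃ lam : Fin p → ℝ, (∀ l, 0 ≤ lam l) ∧ ∑ l, lam l = 1 ∧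
        stationarityMeasure f g h (x k) lam (fun i => ((k : ℝ) + 1) * max (g i (x k)) 0)
          (fun j => ((k : ℝ) + 1) * |h j (x k)|) ≤ ENNReal.ofReal ‖x k - x₀‖ := by
  obtain ⟨U, hU, ⟨-, hg₀, hh₀⟩, hno⟩ := hx₀
  have hF : ∀ i, LocallyLipschitz (problemFamily f g h i) := by
    rintro (l | i | j | j)
    · exact hf l
    · exact hg i
    · exact hh j
    · exact (hh j).neg
  -- `β` marks the objective constraints, kept exact with slack `t`; `γ` marks the penalized ones.
  let c : Fin p ⊕ Fin m ⊕ Fin r ⊕ Fin r → ℝ := Sum.elim (fun l => f l x₀) fun _ => 0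
  let β : Fin p ⊕ Fin m ⊕ Fin r ⊕ Fin r → ℝ := Sum.elim (fun _ => 1) fun _ => 0
  let γ : Fin p ⊕ Fin m ⊕ Fin r ⊕ Fin r → ℝ := Sum.elim (fun _ => 0) fun _ => 1
  have hβ : ∀ i, 0 ≤ β i := by rintro (l | i) <;> simp [β]
  have hγ : ∀ i, 0 ≤ γ i := by rintro (l | i) <;> simp [γ]
  have hγβ : ∀ i, γ i * β i = 0 := by rintro (l | i) <;> simp [β, γ]
  have hβγ : ∀ i, β i ≠ 0 ∨ γ i ≠ 0 := by rintro (l | i) <;> simp [β, γ]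
  have hfeas : ∀ i, problemFamily f g h i x₀ ≤ c i := by
    rintro (l | i | j | j)
    · simp [problemFamily, c]
    · simpa [problemFamily, c] using hg₀ i
    · simp [problemFamily, c, hh₀ j]
    · simp [problemFamily, c, hh₀ j]
  have hopt : ∀ᶠ x in 𝓝 x₀, ∀ t, (∀ i, problemFamily f g h i x ≤ c i + β i * t) → 0 ≤ t := by
    filter_upwards [hU] with x hx t ht
    by_contra! hneg
    refine hno ⟨x, ⟨hx, fun i => ?_, fun j => le_antisymm ?_ ?_⟩, fun l => ?_⟩
    · simpa [problemFamily, c, β] using ht (Sum.inr (Sum.inl i))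
    · simpa [problemFamily, c, β] using ht (Sum.inr (Sum.inr (Sum.inl j)))
    · simpa [problemFamily, c, β] using ht (Sum.inr (Sum.inr (Sum.inr j)))
    · have : f l x ≤ f l x₀ + 1 * t := ht (Sum.inl l)
      linarith
  obtain ⟨t, x, hlim, hcon, hval, hloc⟩ := exists_penalty_minimizers
    (fun i => (hF i).continuous) hγ hβγ hfeas hopt
  refine ⟨x, hlim, fun k l => ?_, ?_⟩
  · have h1 : f l (x k) - f l x₀ - t k ≤ 0 := by
      simpa [problemFamily, c, β, quadPenalty_eq_zero_iff] using hcon k (Sum.inl l)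
    have h2 := hval k
    simp only [Fintype.sum_sum_type, problemFamily, c, β, γ, Sum.elim_inl, Sum.elim_inr, mul_zero,
      zero_mul, mul_one, sub_zero, Finset.sum_const_zero, zero_add, ← Finset.mul_sum] at h2
    simp only [max_mul_self_eq, sq_eq_quadPenalty_add, ← Finset.mul_sum, Finset.sum_add_distrib]
    linarith
  · filter_upwards [hloc] with k hk
    obtain ⟨d, ξ, hd0, hξ, hsum, hd, hzero⟩ := exists_multipliers hF
      (fun i => mul_nonneg (by positivity) (hγ i)) hβ
      (fun i => by rw [mul_assoc, hγβ, mul_zero]) hk (hcon k)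
    have hdg : ∀ i, d (Sum.inr (Sum.inl i)) = ((k : ℝ) + 1) * max (g i (x k)) 0 := fun i => by
      simpa [problemFamily, c, β, γ] using hd (Sum.inr (Sum.inl i)) rfl
    have hdh : ∀ j, d (Sum.inr (Sum.inr (Sum.inl j))) = ((k : ℝ) + 1) * max (h j (x k)) 0 :=
      fun j => by
        simpa [problemFamily, c, β, γ] using hd (Sum.inr (Sum.inr (Sum.inl j))) rfl
    have hdh' : ∀ j, d (Sum.inr (Sum.inr (Sum.inr j))) = ((k : ℝ) + 1) * max (-h j (x k)) 0 :=
      fun j => by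
        simpa [problemFamily, c, β, γ] using hd (Sum.inr (Sum.inr (Sum.inr j))) rfl
    -- The sign of `h j (x k)` selects between subgradients of `h j` and of `-h j`; the multiplier
    -- of the discarded one is zero.
    refine ⟨fun l => d (Sum.inl l), fun l => hd0 _, ?_, sInf_le ⟨fun l => ξ (Sum.inl l),
      fun i => ξ (Sum.inr (Sum.inl i)), fun j => if 0 ≤ h j (x k)
        then ξ (Sum.inr (Sum.inr (Sum.inl j))) else ξ (Sum.inr (Sum.inr (Sum.inr j))),
      fun l => hξ (Sum.inl l), fun i => hξ (Sum.inr (Sum.inl i)), fun j => ?_, ?_⟩⟩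
    · simpa [β, Fintype.sum_sum_type] using hsum
    · dsimp only
      split_ifs
      · exact Or.inl (hξ (Sum.inr (Sum.inr (Sum.inl j))))
      · exact Or.inr (hξ (Sum.inr (Sum.inr (Sum.inr j))))
    · have hpair : ∀ j, (((k : ℝ) + 1) * |h j (x k)|) • (if 0 ≤ h j (x k)
          then ξ (Sum.inr (Sum.inr (Sum.inl j))) else ξ (Sum.inr (Sum.inr (Sum.inr j)))) =
          d (Sum.inr (Sum.inr (Sum.inl j))) • ξ (Sum.inr (Sum.inr (Sum.inl j))) +
          d (Sum.inr (Sum.inr (Sum.inr j))) • ξ (Sum.inr (Sum.inr (Sum.inr j))) := by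
        intro j
        rw [hdh, hdh']
        split_ifs with hj
        · simp [hj, abs_of_nonneg hj]
        · have hj' := (not_le.1 hj).le
          simp [hj', abs_of_nonpos hj']
      simp only [hpair, ← hdg, Finset.sum_add_distrib]
      simp only [Fintype.sum_sum_type] at hzero
      rw [← norm_neg (x k - x₀), neg_eq_of_add_eq_zero_left hzero]
      simp only [add_assoc]

end Problem

end AKKT

/-! ### Selecting constant signs -/

theorem theorem3p1 {n p m r : ℕ}
    (f : Fin p → EuclideanSpace ℝ (Fin n) → ℝ)
    (g : Fin m → EuclideanSpace ℝ (Fin n) → ℝ)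
    (h : Fin r → EuclideanSpace ℝ (Fin n) → ℝ)
    (hf : ∀ l, LocallyLipschitz (f l))
    (hg : ∀ i, LocallyLipschitz (g i))
    (hh : ∀ j, LocallyLipschitz (h j))
    (x₀ : EuclideanSpace ℝ (Fin n))
    (hx₀ : AKKT.IsLocalWeakEfficient f g h x₀) :
    ∃ s : Fin r → ℝ, (∀ j, s j = 1 ∨ s j = -1) ∧
      ∃ (x : ℕ → EuclideanSpace ℝ (Fin n))
        (lam : ℕ → Fin p → ℝ) (mu : ℕ → Fin m → ℝ) (tau : ℕ → Fin r → ℝ),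
        AKKT.SatisfiesAKKT f g h x₀ x lam mu tau ∧
        AKKT.ConditionE1 g (fun j y => s j * h j y) x mu tau ∧
        AKKT.ConditionE2 f g (fun j y => s j * h j y) x₀ x mu tau := by
  obtain ⟨x, hx, hval, hev⟩ := AKKT.exists_akkt_sequence hf hg hh hx₀
  -- Finitely many sign patterns exist, so one of them recurs infinitely often; along that
  -- subsequence `|h j (x k)| = s j * h j (x k)` with `s` fixed.
  have hsign : ∃ᶠ k in atTop, ∃ P : Set (Fin r), P = {j | 0 ≤ h j (x k)} :=
    Frequently.of_forall fun k => ⟨_, rfl⟩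
  obtain ⟨P, hP⟩ := frequently_exists.1 hsign
  obtain ⟨φ, hφ, hφP⟩ := extraction_of_frequently_atTop (hP.and_eventually hev)
  choose hP lam hlam0 hlam1 hlam using hφP
  classical
  let s : Fin r → ℝ := fun j => if j ∈ P then 1 else -1
  have hs : ∀ j, s j = 1 ∨ s j = -1 := fun j => by
    by_cases hj : j ∈ P <;> simp [s, hj]
  have habs : ∀ k j, |h j (x (φ k))| = s j * h j (x (φ k)) := fun k j => by
    have hiff : j ∈ P ↔ 0 ≤ h j (x (φ k)) := by rw [hP k]; rfl
    by_cases hj : j ∈ P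
    · simp [s, hj, abs_of_nonneg (hiff.1 hj)]
    · simp [s, hj, abs_of_neg (not_le.1 (mt hiff.2 hj))]
  have hxφ : Tendsto (fun k => x (φ k)) atTop (𝓝 x₀) := hx.comp hφ.tendsto_atTop
  have hx₀S : x₀ ∈ AKKT.feasibleSet g h := by
    obtain ⟨U, -, ⟨-, hx₀S⟩, -⟩ := hx₀
    exact hx₀S
  refine ⟨s, hs, fun k => x (φ k), lam, fun k i => ((φ k : ℝ) + 1) * max (g i (x (φ k))) 0,
    fun k j => ((φ k : ℝ) + 1) * |h j (x (φ k))|, ⟨hx₀S, hlam0, fun k i => by positivity, hxφ, ?_,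
      hlam1, fun i hi => ?_⟩, ⟨fun k => (φ k : ℝ) + 1, fun k => (φ k : ℝ) + 1,
      fun k => by positivity, fun k => by positivity, fun k i => ⟨rfl, by positivity⟩,
      fun k j => ⟨by dsimp only; rw [habs], by positivity⟩⟩, fun k l => ?_⟩
  · refine tendsto_of_tendsto_of_tendsto_of_le_of_le tendsto_const_nhds ?_ (fun _ => zero_le) hlam
    have h1 : Tendsto (fun k => ‖x (φ k) - x₀‖) atTop (𝓝 0) := by
      simpa using (hxφ.sub_const x₀).norm
    simpa using ENNReal.tendsto_ofReal h1
  -- By continuity an inactive constraint stays negative near `x₀`, so its positive part vanishes.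
  · have hgi := ((hg i).continuous.tendsto x₀).comp hxφ
    filter_upwards [hgi.eventually_lt_const hi] with k hk
    rw [max_eq_right (show g i (x (φ k)) ≤ 0 from le_of_lt hk), mul_zero]
  · refine le_trans (le_of_eq ?_) (hval (φ k) l)
    simp only [← habs, mul_assoc, ← Finset.mul_sum, ← sq, sq_abs]
    ring
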